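/- **Conventions.** An operator space is a complex Banach space $X$ with norms on the matrix spaces $M_n(X)$, $n\ge 1$, satisfying Ruan's axioms (by Ruan's theorem: a closed subspace of some $\mathcal L(H)$, with the norms inherited from $M_n(\mathcal L(H))=\mathcal L(H^n)$). Closed linear subspaces carry the inherited matrix norms. For a linear map $T:X\to Y$ let $\|T\|_n$ be the norm of $(x_{ij})\mapsto (Tx_{ij})$, $M_n(X)\to M_n(Y)$, and $\|T\|_{cb}=\sup_n\|T\|_n$; $T$ is completely bounded if $\|T\|_{cb}<\infty$. Put $M_n=\mathcal L(\ell^2_n)$, and let $d_{cb}(X,Y)$ be the infimum of all $t\ge1$ for which there is a linear isomorphism $e:X\to Y$ with $e,e^{-1}$ completely bounded and $\|e\|_{cb}\|e^{-1}\|_{cb}\le t$. For operator spaces $Z_1,Z_2,\dots$, $(Z_j)_{c_0}$ is the space of sequences $(z_j)$, $z_j\in Z_j$, $\|z_j\|\to0$, where the norm of a matrix over $(Z_j)_{c_0}$ is the supremum over $j$ of the norms of its $j$-th coordinate matrices. * $Z$ is *$\lambda$-injective* if for all operator spaces $X\subset Y$ ($X$ closed in $Y$) every completely bounded $T:X\to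 Z$ has a linear extension $\tilde T:Y\to Z$ with $\|\tilde T\|_{cb}\le\lambda\|T\|_{cb}$. * A family $\mathcal Z$ of operator spaces is *$C$-uniformly exact* ($C\ge1$) if there is a function $\mathbf n:\mathbb N\to\mathbb N$ such that for all $k$, all $Z\in\mathcal Z$ and all $k$-dimensional subspaces $F\subset Z$ there is a subspace $G\subset M_{\mathbf n(k)}$ with $d_{cb}(F,G)\le C$. * $\mathcal Z$ is *of $C$-finite matrix type* ($C\ge1$) if for every finite-dimensional operator space $F$ there is an $n$ such that $\|T\|_{cb}\le C\|T\|_n$ for all linear $T:F\to Z$ and all $Z\in\mathcal Z$. **Theorem.** Let $Z_1,Z_2,\dots$ be $\lambda$-injective operator spaces such that the family $\{Z_1,Z_2,\dots\}$ is $C$-uniformly exact or of $C$-finite matrix type, for some $C\ge1$, and let $Z=(Z_j)_{c_0}$. Let $Y$ be an operator space and $X\subset Y$ a closed linear subspace with $Y/X$ separable. Then for every non-zero completely bounded operator $T:X\to Z$ and every $\varepsilon>0$ there is a completely bounded operator $\tilde T:Y\to Z$ extending $T$ with $$\|\tilde T\|_{cb}<(C\lambda^2+\lambda+\varepsilon)\,\|T\|_{cb}.$$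 -/

import Mathlib

universe u

namespace OpSpace

open scoped ENNReal Topology

/-- The product `a x b ∈ M_n(X)` of scalar matrices `a`, `b` with `x ∈ M_m(X)`. -/
def sandwich {X : Type*} [AddCommMonoid X] [Module ℂ X] {m n : ℕ}
    (a : Matrix (Fin n) (Fin m) ℂ) (x : Matrix (Fin m) (Fin m) X)
    (b : Matrix (Fin m) (Fin n) ℂ) : Matrix (Fin n) (Fin n) X :=
  fun i j => ∑ k, ∑ l, (a i k * b l j) • x k l

/-- The block diagonal matrix `x ⊕ y ∈ M_{m+n}(X)`. -/
def directSum {X : Type*} [Zero X] {m n : ℕ} (x : Matrix (Fin m) (Fin m) X)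
    (y : Matrix (Fin n) (Fin n) X) : Matrix (Fin (m + n)) (Fin (m + n)) X :=
  Matrix.reindex finSumFinEquiv finSumFinEquiv (Matrix.fromBlocks x 0 0 y)

section OperatorSpace

open scoped Matrix.Norms.L2Operator

/-- An operator space structure on a complex normed space `X`: norms on all the matrix spaces
`M_n(X)` that satisfy Ruan's axioms. The norm of a scalar matrix is its operator norm between the
Euclidean spaces. (Each `matNorm n` is definite, see `eq_zero_of_matNorm_eq_zero`.)
Operator spaces are complete; completeness is a separate class, `CompleteSpace X`. -/
class OperatorSpace (X : Type*) [NormedAddCommGroup X] [NormedSpace ℂ X] where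
  /-- the norm of `M_n(X)` -/
  matNorm : ∀ n : ℕ, Seminorm ℂ (Matrix (Fin n) (Fin n) X)
  matNorm_one : ∀ x : X, matNorm 1 (Matrix.of fun _ _ => x) = ‖x‖
  matNorm_directSum : ∀ {m n : ℕ} (x : Matrix (Fin m) (Fin m) X) (y : Matrix (Fin n) (Fin n) X),
    matNorm (m + n) (directSum x y) = max (matNorm m x) (matNorm n y)
  matNorm_sandwich_le : ∀ {m n : ℕ} (a : Matrix (Fin n) (Fin m) ℂ)
    (x : Matrix (Fin m) (Fin m) X) (b : Matrix (Fin m) (Fin n) ℂ),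
    matNorm n (sandwich a x b) ≤ ‖a‖ * matNorm m x * ‖b‖

open OperatorSpace (matNorm matNorm_one matNorm_directSum matNorm_sandwich_le)

variable {X : Type*} [NormedAddCommGroup X] [NormedSpace ℂ X]

theorem eq_zero_of_matNorm_eq_zero [OperatorSpace X] {n : ℕ} (x : Matrix (Fin n) (Fin n) X)
    (hx : matNorm n x = 0) : x = 0 := by
  ext i j
  have h := matNorm_sandwich_le (Matrix.single (0 : Fin 1) i (1 : ℂ)) x
    (Matrix.single j (0 : Fin 1) (1 : ℂ))
  have e : sandwich (Matrix.single (0 : Fin 1) i (1 : ℂ)) x (Matrix.single j (0 : Fin 1) (1 : ℂ))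
      = Matrix.of fun _ _ => x i j := by
    ext p q
    fin_cases p; fin_cases q
    simp only [sandwich, Matrix.of_apply]
    rw [Finset.sum_eq_single i, Finset.sum_eq_single j]
    · simp
    · intro l _ hl
      simp [Ne.symm hl]
    · simp
    · intro k _ hk
      simp [Matrix.single_apply, Ne.symm hk]
    · simp
  rw [e, matNorm_one, hx] at h
  have h0 : ‖x i j‖ ≤ 0 := by simpa using h
  simpa using h0

theorem sum_le {ι : Type*} {n : ℕ} (p : Seminorm ℂ (Matrix (Fin n) (Fin n) X)) (s : Finset ι)
    (f : ι → Matrix (Fin n) (Fin n) X) : p (∑ i ∈ s, f i) ≤ ∑ i ∈ s, p (f i) :=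
  Finset.le_sum_of_subadditive p (map_zero p).le (map_add_le_add p) s f

/-- The norm of `M_n(X)` is bounded by the norms of the entries. -/
theorem exists_matNorm_le (n : ℕ) : ∃ K : ℝ, 0 ≤ K ∧
    ∀ (X : Type u) [NormedAddCommGroup X] [NormedSpace ℂ X] [OperatorSpace X]
      (x : Matrix (Fin n) (Fin n) X), matNorm n x ≤ K * ∑ i, ∑ j, ‖x i j‖ := by
  refine ⟨∑ i : Fin n, ∑ j : Fin n, ‖Matrix.single i (0 : Fin 1) (1 : ℂ)‖ *
    ‖Matrix.single (0 : Fin 1) j (1 : ℂ)‖, by positivity, ?_⟩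
  intro X _ _ _ x
  have hx : x = ∑ i : Fin n, ∑ j : Fin n, sandwich (Matrix.single i (0 : Fin 1) (1 : ℂ))
      (Matrix.of fun _ _ => x i j) (Matrix.single (0 : Fin 1) j (1 : ℂ)) := by
    ext p q
    simp only [Matrix.sum_apply]
    rw [Finset.sum_eq_single p, Finset.sum_eq_single q]
    · simp [sandwich]
    · intro l _ hl
      simp [sandwich, Matrix.single_apply, hl]
    · simp
    · intro k _ hk
      simp [sandwich, Matrix.single_apply, hk]
    · simp
  conv_lhs => rw [hx]
  refine (sum_le (matNorm n) _ _).trans ?_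
  rw [Finset.sum_mul]
  refine Finset.sum_le_sum fun i _ => ?_
  refine (sum_le (matNorm n) _ _).trans ?_
  rw [Finset.sum_mul]
  refine Finset.sum_le_sum fun j _ => ?_
  refine (matNorm_sandwich_le _ _ _).trans ?_
  rw [matNorm_one]
  have h1 : ‖x i j‖ ≤ ∑ i, ∑ j, ‖x i j‖ :=
    (Finset.single_le_sum (f := fun j => ‖x i j‖) (fun _ _ => norm_nonneg _)
      (Finset.mem_univ j)).trans
    (Finset.single_le_sum (f := fun i => ∑ j, ‖x i j‖)
      (fun _ _ => Finset.sum_nonneg fun _ _ => norm_nonneg _) (Finset.mem_univ i))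
  calc _ = ‖Matrix.single i (0 : Fin 1) (1 : ℂ)‖ * ‖Matrix.single (0 : Fin 1) j (1 : ℂ)‖
        * ‖x i j‖ := by ring
    _ ≤ _ := by gcongr

/-! ### Subspaces -/

/-- A linear subspace of an operator space, with the inherited matrix norms. -/
noncomputable instance [OperatorSpace X] (S : Submodule ℂ X) : OperatorSpace S where
  matNorm n := (matNorm n).comp S.subtype.mapMatrix
  matNorm_one x := by
    change matNorm 1 (Matrix.of fun _ _ => (x : X)) = ‖(x : X)‖
    exact matNorm_one (x : X)
  matNorm_directSum x y := by
    simp only [Seminorm.comp_apply]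
    rw [← matNorm_directSum]
    congr 1
    ext i j
    simp only [directSum, LinearMap.mapMatrix_apply, Matrix.map_apply, Matrix.reindex_apply,
      Matrix.submatrix_apply]
    rcases finSumFinEquiv.symm i with i | i <;> rcases finSumFinEquiv.symm j with j | j <;> simp
  matNorm_sandwich_le a x b := by
    simp only [Seminorm.comp_apply]
    refine le_trans (le_of_eq ?_) (matNorm_sandwich_le a (S.subtype.mapMatrix x) b)
    congr 1
    ext i j
    simp [sandwich]

/-! ### Bounded operators on a Hilbert space -/

section Hilbert

variable {H : Type*} [NormedAddCommGroup H] [InnerProductSpace ℂ H]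

/-- The operator on `H^n = H ⊕ ⋯ ⊕ H` (Hilbert space sum) given by an `n × n` matrix of operators
on `H`: `(T v) i = ∑ j, T i j (v j)`. -/
noncomputable def toOp (n : ℕ) : Matrix (Fin n) (Fin n) (H →L[ℂ] H) →ₗ[ℂ]
    (PiLp 2 (fun _ : Fin n => H) →L[ℂ] PiLp 2 (fun _ : Fin n => H)) where
  toFun T := ((PiLp.continuousLinearEquiv 2 ℂ (fun _ : Fin n => H)).symm :
      (Fin n → H) →L[ℂ] PiLp 2 (fun _ : Fin n => H)) ∘L
    ContinuousLinearMap.pi fun i => ∑ j, T i j ∘L PiLp.proj 2 (fun _ : Fin n => H) j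
  map_add' S T := by
    ext v i
    simp [Finset.sum_add_distrib]
  map_smul' c T := by
    ext v i
    simp [Finset.smul_sum]

theorem toOp_apply (n : ℕ) (T : Matrix (Fin n) (Fin n) (H →L[ℂ] H))
    (v : PiLp 2 (fun _ : Fin n => H)) (i : Fin n) : toOp n T v i = ∑ j, T i j (v j) := by
  simp [toOp]

theorem sum_norm_sq_le {m n : ℕ} (a : Matrix (Fin n) (Fin m) ℂ) (v : Fin m → H) :
    ∑ i, ‖∑ k, a i k • v k‖ ^ 2 ≤ ‖a‖ ^ 2 * ∑ k, ‖v k‖ ^ 2 := by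
  let S := Submodule.span ℂ (Set.range v)
  have : FiniteDimensional ℂ S := FiniteDimensional.span_of_finite ℂ (Set.finite_range v)
  let b := stdOrthonormalBasis ℂ S
  let w : Fin m → S := fun k => ⟨v k, Submodule.subset_span ⟨k, rfl⟩⟩
  have hb : ∀ z : S, ‖(z : H)‖ ^ 2 = ∑ s, ‖b.repr z s‖ ^ 2 := by
    intro z
    rw [← EuclideanSpace.norm_sq_eq, LinearIsometryEquiv.norm_map, Submodule.coe_norm]
  have h1 : ∀ i, ‖∑ k, a i k • v k‖ ^ 2 = ∑ s, ‖∑ k, a i k * b.repr (w k) s‖ ^ 2 := by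
    intro i
    have : (∑ k, a i k • v k) = ((∑ k, a i k • w k : S) : H) := by simp [w]
    rw [this, hb]
    simp
  have h2 : ∀ k, ‖v k‖ ^ 2 = ∑ s, ‖b.repr (w k) s‖ ^ 2 := fun k => hb (w k)
  simp only [h1, h2]
  rw [Finset.sum_comm, Finset.sum_comm (s := (Finset.univ : Finset (Fin m))), Finset.mul_sum]
  refine Finset.sum_le_sum fun s _ => ?_
  have h3 := Matrix.l2_opNorm_mulVec a (WithLp.toLp 2 fun k => b.repr (w k) s)
  have h4 := pow_le_pow_left₀ (norm_nonneg _) h3 2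
  rw [mul_pow, EuclideanSpace.norm_sq_eq, EuclideanSpace.norm_sq_eq] at h4
  simpa [Matrix.mulVec, dotProduct] using h4

theorem toOp_norm_le {n : ℕ} (T : Matrix (Fin n) (Fin n) (H →L[ℂ] H)) {c : ℝ} (hc : 0 ≤ c)
    (h : ∀ v : Fin n → H, ∑ i, ‖∑ j, T i j (v j)‖ ^ 2 ≤ c ^ 2 * ∑ j, ‖v j‖ ^ 2) :
    ‖toOp n T‖ ≤ c := by
  refine ContinuousLinearMap.opNorm_le_bound _ hc fun v => ?_
  refine le_of_sq_le_sq ?_ (by positivity)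
  rw [mul_pow, PiLp.norm_sq_eq_of_L2, PiLp.norm_sq_eq_of_L2]
  simpa only [toOp_apply] using h v

theorem toOp_norm_bound {n : ℕ} (T : Matrix (Fin n) (Fin n) (H →L[ℂ] H)) (v : Fin n → H) :
    ∑ i, ‖∑ j, T i j (v j)‖ ^ 2 ≤ ‖toOp n T‖ ^ 2 * ∑ j, ‖v j‖ ^ 2 := by
  have h := pow_le_pow_left₀ (norm_nonneg _) ((toOp n T).le_opNorm (WithLp.toLp 2 v)) 2
  rw [mul_pow, PiLp.norm_sq_eq_of_L2, PiLp.norm_sq_eq_of_L2] at h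
  simpa only [toOp_apply] using h

/-- The natural operator space structure of `L(H)`: the norm of an `n × n` matrix of operators
is its norm as an operator on `H^n`. -/
noncomputable instance : OperatorSpace (H →L[ℂ] H) where
  matNorm n := (normSeminorm ℂ (PiLp 2 (fun _ : Fin n => H) →L[ℂ] PiLp 2 (fun _ : Fin n => H))).comp (toOp n)
  matNorm_one T := by
    simp only [Seminorm.comp_apply, coe_normSeminorm]
    refine le_antisymm (toOp_norm_le _ (norm_nonneg _) fun v => ?_)
      (ContinuousLinearMap.opNorm_le_bound _
        (norm_nonneg (toOp 1 (Matrix.of fun _ _ => T))) fun v => ?_)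
    · simp only [Finset.univ_unique, Fin.default_eq_zero, Finset.sum_singleton]
      rw [← mul_pow]
      exact pow_le_pow_left₀ (norm_nonneg _) (T.le_opNorm _) 2
    · have h := toOp_norm_bound (n := 1) (Matrix.of fun _ _ => T) (fun _ => v)
      simp only [Finset.univ_unique, Finset.sum_singleton] at h
      rw [← mul_pow] at h
      exact le_of_sq_le_sq h (by positivity)
  matNorm_directSum {m n} x y := by
    simp only [Seminorm.comp_apply, coe_normSeminorm]
    have hd : ∀ v : Fin (m + n) → H,
        ∑ i, ‖∑ j, directSum x y i j (v j)‖ ^ 2 =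
          ∑ i, ‖∑ j, x i j (v (Fin.castAdd n j))‖ ^ 2 +
          ∑ i, ‖∑ j, y i j (v (Fin.natAdd m j))‖ ^ 2 := by
      intro v
      simp [Fin.sum_univ_add, directSum]
    have hm : 0 ≤ max ‖toOp m x‖ ‖toOp n y‖ := le_max_of_le_left (norm_nonneg (toOp m x))
    refine le_antisymm (toOp_norm_le _ hm fun v => ?_) (max_le ?_ ?_)
    · rw [hd, Fin.sum_univ_add, mul_add]
      refine add_le_add ((toOp_norm_bound x _).trans ?_) ((toOp_norm_bound y _).trans ?_)
      · gcongr; exact le_max_left _ _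
      · gcongr; exact le_max_right _ _
    · refine toOp_norm_le _ (norm_nonneg (toOp (m + n) (directSum x y))) fun v => ?_
      have h := toOp_norm_bound (directSum x y) (Fin.append v 0)
      rw [hd, Fin.sum_univ_add] at h
      simpa using h
    · refine toOp_norm_le _ (norm_nonneg (toOp (m + n) (directSum x y))) fun v => ?_
      have h := toOp_norm_bound (directSum x y) (Fin.append 0 v)
      rw [hd, Fin.sum_univ_add] at h
      simpa using h
  matNorm_sandwich_le {m n} a x b := by
    simp only [Seminorm.comp_apply, coe_normSeminorm]
    refine toOp_norm_le _ (by positivity) fun v => ?_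
    have e : ∀ i, ∑ j, sandwich a x b i j (v j) =
        ∑ k, a i k • ∑ l, x k l (∑ j, b l j • v j) := by
      intro i
      simp only [sandwich, sum_apply, smul_apply,
        map_sum, map_smul, Finset.smul_sum, smul_smul]
      rw [Finset.sum_comm]
      refine Finset.sum_congr rfl fun k _ => ?_
      rw [Finset.sum_comm]
    simp only [e]
    refine (sum_norm_sq_le a _).trans ?_
    rw [mul_pow, mul_pow, mul_assoc, mul_assoc]
    refine mul_le_mul_of_nonneg_left ?_ (by positivity)
    refine (toOp_norm_bound x _).trans ?_
    exact mul_le_mul_of_nonneg_left (sum_norm_sq_le b v) (by positivity)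

end Hilbert

/-- The operator space `M_n = L(ℓ²_n)`. -/
abbrev MatrixSpace (n : ℕ) : Type := EuclideanSpace ℂ (Fin n) →L[ℂ] EuclideanSpace ℂ (Fin n)

/-! ### Direct sums -/

section Sums

variable {ι : Type*} (Z : ι → Type u) [∀ j, NormedAddCommGroup (Z j)] [∀ j, NormedSpace ℂ (Z j)]
  [∀ j, OperatorSpace (Z j)]

theorem bddAbove_matNorm (n : ℕ) (x : Matrix (Fin n) (Fin n) (lp Z ∞)) :
    BddAbove (Set.range fun j => matNorm n (x.map fun f => f j)) := by
  obtain ⟨K, hK, h⟩ := exists_matNorm_le.{u} n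
  refine ⟨K * ∑ i, ∑ k, ‖x i k‖, ?_⟩
  rintro _ ⟨j, rfl⟩
  refine (h _ _).trans ?_
  gcongr with i _ k _
  exact lp.norm_apply_le_norm ENNReal.top_ne_zero (x i k) j

/-- The operator space `(Z_j)_{ℓ^∞}` of all bounded sequences `f j ∈ Z j`. The norm of a matrix is
the supremum over `j` of the norms of its `j`-th coordinates. -/
noncomputable instance : OperatorSpace (lp Z ∞) where
  matNorm n := Seminorm.of (fun x => ⨆ j, matNorm n (x.map fun f => f j))
    (fun x y => by
      refine Real.iSup_le (fun j => ?_) (add_nonneg (Real.iSup_nonneg fun _ => apply_nonneg _ _)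
        (Real.iSup_nonneg fun _ => apply_nonneg _ _))
      refine le_trans ?_ (add_le_add (le_ciSup (bddAbove_matNorm Z n x) j)
        (le_ciSup (bddAbove_matNorm Z n y) j))
      exact map_add_le_add (matNorm n) (x.map fun f => f j) (y.map fun f => f j))
    (fun c x => by
      rw [Real.mul_iSup_of_nonneg (norm_nonneg _)]
      refine iSup_congr fun j => ?_
      exact map_smul_eq_mul (matNorm n) c (x.map fun f => f j))
  matNorm_one f := by
    change (⨆ j, matNorm 1 (Matrix.of fun _ _ => f j)) = ‖f‖
    simp only [matNorm_one, lp.norm_eq_ciSup]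
  matNorm_directSum {m n} x y := by
    change (⨆ j, matNorm (m + n) ((directSum x y).map fun f => f j)) =
      max (⨆ j, matNorm m (x.map fun f => f j)) (⨆ j, matNorm n (y.map fun f => f j))
    have e : ∀ j, (directSum x y).map (fun f => f j) =
        directSum (x.map fun f => f j) (y.map fun f => f j) := by
      intro j
      ext i k
      simp only [directSum, Matrix.map_apply, Matrix.reindex_apply, Matrix.submatrix_apply]
      rcases finSumFinEquiv.symm i with i | i <;> rcases finSumFinEquiv.symm k with k | k <;> simp
    simp only [e, matNorm_directSum]
    rcases isEmpty_or_nonempty ι with h | h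
    · simp
    · exact ciSup_sup_eq (bddAbove_matNorm Z m x) (bddAbove_matNorm Z n y)
  matNorm_sandwich_le {m n} a x b := by
    change (⨆ j, matNorm n ((sandwich a x b).map fun f => f j)) ≤
      ‖a‖ * (⨆ j, matNorm m (x.map fun f => f j)) * ‖b‖
    have h0 : 0 ≤ ⨆ j, matNorm m (x.map fun f => f j) := Real.iSup_nonneg fun _ => apply_nonneg _ _
    refine Real.iSup_le (fun j => ?_) (by positivity)
    have e : (sandwich a x b).map (fun f => f j) = sandwich a (x.map fun f => f j) b := by
      ext i k
      change lp.evalₗ (𝕜 := ℂ) Z ∞ j (∑ k', ∑ l, (a i k' * b l k) • x k' l) = _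
      simp only [map_sum, map_smul]
      rfl
    rw [e]
    refine (matNorm_sandwich_le _ _ _).trans ?_
    gcongr
    exact le_ciSup (bddAbove_matNorm Z m x) j

end Sums

/-- The operator space `(Z_j)_{c_0}` of all sequences `f j ∈ Z j` with `‖f j‖ → 0`, a subspace of
`(Z_j)_{ℓ^∞}`. -/
def c0Sum (Z : ℕ → Type u) [∀ j, NormedAddCommGroup (Z j)] [∀ j, NormedSpace ℂ (Z j)] :
    Submodule ℂ (lp Z ∞) where
  carrier := {f | Filter.Tendsto (fun j => ‖f j‖) Filter.atTop (𝓝 0)}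
  zero_mem' := by simp
  add_mem' {f g} hf hg := by
    refine squeeze_zero (fun _ => norm_nonneg _) (fun j => ?_) (by simpa using hf.add hg)
    exact norm_add_le (f j) (g j)
  smul_mem' c f hf := by
    have h : ∀ j, ‖(c • f : lp Z ∞) j‖ = ‖c‖ * ‖f j‖ := fun j => norm_smul c (f j)
    change Filter.Tendsto (fun j => ‖(c • f : lp Z ∞) j‖) Filter.atTop (𝓝 0)
    simp only [h]
    simpa using Filter.Tendsto.const_mul ‖c‖ hf

/-! ### Completely bounded maps -/

section CB

variable {Y : Type*} [NormedAddCommGroup Y] [NormedSpace ℂ Y] [OperatorSpace X] [OperatorSpace Y]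

/-- `‖T‖_n`, the norm of the map `(x_ij) ↦ (T x_ij)` from `M_n(X)` to `M_n(Y)` (possibly `∞`). -/
noncomputable def ampNorm (n : ℕ) (T : X →ₗ[ℂ] Y) : ℝ≥0∞ :=
  ⨆ (x : Matrix (Fin n) (Fin n) X) (_ : matNorm n x ≤ 1), ENNReal.ofReal (matNorm n (x.map T))

/-- `‖T‖_cb = sup_n ‖T‖_n`. The map `T` is completely bounded iff this is finite. -/
noncomputable def cbNorm (T : X →ₗ[ℂ] Y) : ℝ≥0∞ := ⨆ n, ampNorm n T

/-- `T` is completely bounded. Such a map is continuous, since `‖T‖ = ‖T‖_1 ≤ ‖T‖_cb`. -/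
def IsCompletelyBounded (T : X →ₗ[ℂ] Y) : Prop := cbNorm T < ∞

variable (X Y) in
/-- The completely bounded distance `d_cb(X, Y)`: the infimum of all `t ≥ 1` such that there is a
linear isomorphism `e` of `X` and `Y` with `e` and `e⁻¹` completely bounded and
`‖e‖_cb ‖e⁻¹‖_cb ≤ t`. It is `∞` if there is none. -/
noncomputable def cbDist : ℝ≥0∞ :=
  sInf {t | 1 ≤ t ∧ ∃ e : X ≃ₗ[ℂ] Y, IsCompletelyBounded e.toLinearMap ∧
    IsCompletelyBounded e.symm.toLinearMap ∧ cbNorm e.toLinearMap * cbNorm e.symm.toLinearMap ≤ t}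

end CB

/-- The operator space `Z` is `r`-injective: for all operator spaces `X ⊆ Y`, every completely
bounded map `T : X → Z` has an extension `T' : Y → Z` with `‖T'‖_cb ≤ r ‖T‖_cb`. -/
def IsInjectiveWith (r : ℝ) (Z : Type u) [NormedAddCommGroup Z] [NormedSpace ℂ Z]
    [OperatorSpace Z] : Prop :=
  ∀ (Y : Type u) [NormedAddCommGroup Y] [NormedSpace ℂ Y] [CompleteSpace Y] [OperatorSpace Y]
    (X : Submodule ℂ Y), IsClosed (X : Set Y) →
    ∀ T : X →ₗ[ℂ] Z, IsCompletelyBounded T →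
      ∃ T' : Y →ₗ[ℂ] Z, (∀ x : X, T' x = T x) ∧ cbNorm T' ≤ ENNReal.ofReal r * cbNorm T

section Families

variable {ι : Type*} (C : ℝ) (Z : ι → Type u) [∀ j, NormedAddCommGroup (Z j)]
  [∀ j, NormedSpace ℂ (Z j)] [∀ j, OperatorSpace (Z j)]

/-- The family `Z` is `C`-uniformly exact: there is a function `N` such that every `k`-dimensional
subspace of a member of the family is at distance at most `C` from a subspace of `M_{N(k)}`. -/
def IsUniformlyExact : Prop :=
  1 ≤ C ∧ ∃ N : ℕ → ℕ, ∀ (k : ℕ) (j : ι) (F : Submodule ℂ (Z j)), FiniteDimensional ℂ F →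
    Module.finrank ℂ F = k →
      ∃ G : Submodule ℂ (MatrixSpace (N k)), cbDist F G ≤ ENNReal.ofReal C

/-- The family `Z` is of `C`-finite matrix type: for every finite-dimensional operator space `F`
there is an `n` such that `‖T‖_cb ≤ C ‖T‖_n` for all linear maps from `F` to members of `Z`. -/
def IsOfFiniteMatrixType : Prop :=
  1 ≤ C ∧ ∀ (F : Type u) [NormedAddCommGroup F] [NormedSpace ℂ F] [OperatorSpace F],
    FiniteDimensional ℂ F →
      ∃ n : ℕ, ∀ (j : ι) (T : F →ₗ[ℂ] Z j), cbNorm T ≤ ENNReal.ofReal C * ampNorm n T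

end Families

end OperatorSpace

end OpSpace

/-! Each coordinate of `T` extends by injectivity to `A j : Y → Z j` with cb-norm at most `lam * t`,
where `t` is the cb-norm of `T`. The `A j` tend to `0` pointwise on `X` but perhaps not on `Y`, so
they need not define a map into the `c_0`-sum. They are corrected by operators `S j ∘ X.mkQ`, which
vanish on `X`: it suffices that `S j : Y ⧸ X → Z j` are uniformly completely bounded and `A j - S j
∘ X.mkQ` tends to `0` on lifts of a dense sequence of `Y ⧸ X`.

To find `S j`, take the span `F` of finitely many classes and a linear section `σ : F → Y`. A matrix
over `F` has a lift `y` to `Y` of almost the same norm, and `y` differs from its image under `σ` by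
a matrix over `X`, where `A j` is eventually small. Compactness of balls makes this uniform: for
fixed `n` the `n`-th norm of `A j ∘ σ` is eventually at most `lam * t + δ`
(`eventually_ampNorm_comp_section_le`). Finite matrix type turns this into a cb-bound at the cost of
`C`, and injectivity extends the map from `F` to `Y ⧸ X` at the cost of `lam`. A diagonal choice
lets `F` grow with `j`. The total is `lam * t + lam * C * (lam * t + δ)`.

Uniform exactness reduces to finite matrix type by Smith's lemma (`cbNorm_le_ampNorm_matrixSpace`).
-/

namespace OpSpace

open scoped ENNReal Topology
open OperatorSpace (matNorm matNorm_one matNorm_directSum matNorm_sandwich_le)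

/-! ### Linear maps and Ruan's matrix operations -/

section Algebra

variable {X Y : Type*} [AddCommGroup X] [Module ℂ X] [AddCommGroup Y] [Module ℂ Y]

theorem map_sandwich (T : X →ₗ[ℂ] Y) {m n : ℕ} (a : Matrix (Fin n) (Fin m) ℂ)
    (x : Matrix (Fin m) (Fin m) X) (b : Matrix (Fin m) (Fin n) ℂ) :
    (sandwich a x b).map T = sandwich a (x.map T) b := by
  ext i j
  simp [sandwich]

theorem map_directSum (T : X →ₗ[ℂ] Y) {m n : ℕ} (x : Matrix (Fin m) (Fin m) X)
    (y : Matrix (Fin n) (Fin n) X) :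
    (directSum x y).map T = directSum (x.map T) (y.map T) := by
  ext i j
  simp only [directSum, Matrix.map_apply, Matrix.reindex_apply, Matrix.submatrix_apply]
  rcases finSumFinEquiv.symm i with i | i <;> rcases finSumFinEquiv.symm j with j | j <;> simp

end Algebra

/-! ### Norms of amplifications and compressions -/

section Amplifications

variable {X Y W : Type*} [NormedAddCommGroup X] [NormedSpace ℂ X] [OperatorSpace X]
  [NormedAddCommGroup Y] [NormedSpace ℂ Y] [OperatorSpace Y]
  [NormedAddCommGroup W] [NormedSpace ℂ W] [OperatorSpace W]

theorem ofReal_matNorm_map_le (n : ℕ) (T : X →ₗ[ℂ] Y) (x : Matrix (Fin n) (Fin n) X) :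
    ENNReal.ofReal (matNorm n (x.map T)) ≤ ampNorm n T * ENNReal.ofReal (matNorm n x) := by
  have h0 : 0 ≤ matNorm n x := apply_nonneg _ x
  rcases h0.eq_or_lt with h | h
  -- With `ampNorm n T = ∞` allowed, definiteness of the matrix norm is needed here: the right-hand
  -- side is then `∞ * 0 = 0`.
  · obtain rfl : x = 0 := eq_zero_of_matNorm_eq_zero x h.symm
    have : (0 : Matrix (Fin n) (Fin n) X).map T = 0 := by ext; simp
    simp [this]
  · set r := matNorm n x with hr
    have h1 : matNorm n ((r : ℂ)⁻¹ • x) ≤ 1 := by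
      rw [map_smul_eq_mul, norm_inv, Complex.norm_real, Real.norm_of_nonneg h.le, ← hr,
        inv_mul_cancel₀ h.ne']
    have h2 : ENNReal.ofReal (matNorm n (((r : ℂ)⁻¹ • x).map T)) ≤ ampNorm n T :=
      le_iSup₂_of_le ((r : ℂ)⁻¹ • x) h1 le_rfl
    have h3 : x.map T = (r : ℂ) • ((r : ℂ)⁻¹ • x).map T := by
      ext i j
      have : (r : ℂ) ≠ 0 := by exact_mod_cast h.ne'
      simp [smul_smul, this]
    rw [h3, map_smul_eq_mul, Complex.norm_real, Real.norm_of_nonneg h.le, mul_comm,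
      ENNReal.ofReal_mul (apply_nonneg _ _)]
    gcongr

theorem ampNorm_le_of_forall {n : ℕ} {T : X →ₗ[ℂ] Y} {c : ℝ≥0∞}
    (h : ∀ x : Matrix (Fin n) (Fin n) X,
      ENNReal.ofReal (matNorm n (x.map T)) ≤ c * ENNReal.ofReal (matNorm n x)) :
    ampNorm n T ≤ c := by
  refine iSup₂_le fun x hx => (h x).trans ?_
  calc _ ≤ c * 1 := by gcongr; simpa using hx
    _ = c := mul_one c

theorem ampNorm_le_cbNorm (n : ℕ) (T : X →ₗ[ℂ] Y) : ampNorm n T ≤ cbNorm T :=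
  le_iSup (fun n => ampNorm n T) n

theorem ampNorm_le_ofReal {n : ℕ} {T : X →ₗ[ℂ] Y} {c : ℝ}
    (h : ∀ x : Matrix (Fin n) (Fin n) X, matNorm n x ≤ 1 → matNorm n (x.map T) ≤ c) :
    ampNorm n T ≤ ENNReal.ofReal c :=
  iSup₂_le fun x hx => ENNReal.ofReal_le_ofReal (h x hx)

theorem cbNorm_le_ofReal {T : X →ₗ[ℂ] Y} {c : ℝ} (hc : 0 ≤ c)
    (h : ∀ n (x : Matrix (Fin n) (Fin n) X), matNorm n (x.map T) ≤ c * matNorm n x) :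
    cbNorm T ≤ ENNReal.ofReal c :=
  iSup_le fun n => ampNorm_le_of_forall fun x => by
    rw [← ENNReal.ofReal_mul hc]
    exact ENNReal.ofReal_le_ofReal (h n x)

theorem matNorm_map_le_of_ampNorm_le {n : ℕ} {T : X →ₗ[ℂ] Y} {c : ℝ} (hc : 0 ≤ c)
    (h : ampNorm n T ≤ ENNReal.ofReal c) (x : Matrix (Fin n) (Fin n) X) :
    matNorm n (x.map T) ≤ c * matNorm n x := by
  have h1 : ENNReal.ofReal (matNorm n (x.map T)) ≤ ENNReal.ofReal (c * matNorm n x) := by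
    rw [ENNReal.ofReal_mul hc]
    exact (ofReal_matNorm_map_le n T x).trans (by gcongr)
  exact (ENNReal.ofReal_le_ofReal_iff (mul_nonneg hc (apply_nonneg _ _))).1 h1

theorem matNorm_map_le_of_cbNorm_le {T : X →ₗ[ℂ] Y} {c : ℝ} (hc : 0 ≤ c)
    (h : cbNorm T ≤ ENNReal.ofReal c) (n : ℕ) (x : Matrix (Fin n) (Fin n) X) :
    matNorm n (x.map T) ≤ c * matNorm n x :=
  matNorm_map_le_of_ampNorm_le hc ((ampNorm_le_cbNorm n T).trans h) x

theorem norm_apply_le_of_cbNorm_le {T : X →ₗ[ℂ] Y} {c : ℝ} (hc : 0 ≤ c)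
    (h : cbNorm T ≤ ENNReal.ofReal c) (x : X) : ‖T x‖ ≤ c * ‖x‖ := by
  rw [← matNorm_one, ← matNorm_one]
  exact matNorm_map_le_of_cbNorm_le hc h 1 (Matrix.of fun _ _ => x)

theorem eq_zero_of_cbNorm_eq_zero {T : X →ₗ[ℂ] Y} (h : cbNorm T = 0) : T = 0 := by
  ext x
  simpa using norm_apply_le_of_cbNorm_le (T := T) le_rfl (by simp [h]) x

theorem ampNorm_comp_le (n : ℕ) (S : Y →ₗ[ℂ] W) (T : X →ₗ[ℂ] Y) :
    ampNorm n (S ∘ₗ T) ≤ ampNorm n S * ampNorm n T :=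
  ampNorm_le_of_forall fun x => by
    refine (ofReal_matNorm_map_le n S (x.map T)).trans ?_
    rw [mul_assoc]
    gcongr
    exact ofReal_matNorm_map_le n T x

theorem cbNorm_comp_le (S : Y →ₗ[ℂ] W) (T : X →ₗ[ℂ] Y) :
    cbNorm (S ∘ₗ T) ≤ cbNorm S * cbNorm T :=
  iSup_le fun n => (ampNorm_comp_le n S T).trans <| by
    gcongr <;> exact ampNorm_le_cbNorm _ _

/-- Padding a matrix with a zero block changes neither its norm nor the norm of its image. -/
theorem ampNorm_mono (T : X →ₗ[ℂ] Y) : Monotone fun n => ampNorm n T :=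
  monotone_nat_of_le_succ fun n => by
    refine ampNorm_le_of_forall fun x => ?_
    have h := ofReal_matNorm_map_le (n + 1) T (directSum x (0 : Matrix (Fin 1) (Fin 1) X))
    have h0 : (0 : Matrix (Fin 1) (Fin 1) X).map T = 0 := by ext; simp
    simpa [map_directSum, h0, matNorm_directSum, max_eq_left] using h

open scoped Matrix.Norms.L2Operator in
-- This is the C*-identity. Equality would fail for `n = 0`.
theorem norm_le_one_of_conjTranspose_mul_self {m n : ℕ} {b : Matrix (Fin m) (Fin n) ℂ}
    (h : b.conjTranspose * b = 1) : ‖b‖ ≤ 1 := by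
  have h1 := Matrix.l2_opNorm_conjTranspose_mul_self b
  have h2 : ‖(1 : Matrix (Fin n) (Fin n) ℂ)‖ ≤ 1 := by
    rw [← Matrix.diagonal_one, Matrix.l2_opNorm_diagonal]
    exact (pi_norm_le_iff_of_nonneg zero_le_one).2 fun i => by simp
  rw [h] at h1
  nlinarith [norm_nonneg b]

/-- Passing to a submatrix does not increase the norm. -/
theorem matNorm_submatrix_le {m n : ℕ} (x : Matrix (Fin n) (Fin n) X) {f g : Fin m → Fin n}
    (hf : f.Injective) (hg : g.Injective) : matNorm m (x.submatrix f g) ≤ matNorm n x := by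
  open scoped Matrix.Norms.L2Operator in
  have key : ∀ {g : Fin m → Fin n}, g.Injective →
      ‖(1 : Matrix (Fin n) (Fin n) ℂ).submatrix id g‖ ≤ 1 := fun {g} hg =>
    norm_le_one_of_conjTranspose_mul_self (by
      ext i j
      simp [Matrix.mul_apply, Matrix.one_apply, hg.eq_iff])
  have h := matNorm_sandwich_le ((1 : Matrix (Fin n) (Fin n) ℂ).submatrix id f).conjTranspose x
    ((1 : Matrix (Fin n) (Fin n) ℂ).submatrix id g)
  have e : sandwich ((1 : Matrix (Fin n) (Fin n) ℂ).submatrix id f).conjTranspose x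
      ((1 : Matrix (Fin n) (Fin n) ℂ).submatrix id g) = x.submatrix f g := by
    ext i j
    simp [sandwich, Matrix.one_apply]
  rw [e, Matrix.l2_opNorm_conjTranspose] at h
  have h0 : 0 ≤ matNorm n x := apply_nonneg _ x
  calc _ ≤ _ := h
    _ ≤ 1 * matNorm n x * 1 := by
      gcongr
      exacts [key hf, key hg]
    _ = _ := by ring

/-- The entries of a matrix over an operator space are bounded by its norm. -/
theorem norm_entry_le_matNorm {n : ℕ} (x : Matrix (Fin n) (Fin n) X) (i j : Fin n) :
    ‖x i j‖ ≤ matNorm n x := by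
  rw [← matNorm_one]
  exact matNorm_submatrix_le x (f := fun _ : Fin 1 => i) (g := fun _ => j)
    (Function.injective_of_subsingleton _) (Function.injective_of_subsingleton _)

theorem matNorm_coe (S : Submodule ℂ X) {n : ℕ} (x : Matrix (Fin n) (Fin n) S) :
    matNorm n x = matNorm n (x.map S.subtype) := rfl

end Amplifications

/-! ### Quotient operator spaces -/

section Quotient

variable {Y : Type*} [NormedAddCommGroup Y] [NormedSpace ℂ Y] [OperatorSpace Y]
  (X : Submodule ℂ Y)

/-- The quotient norm on `M_n(Y/X) = M_n(Y)/M_n(X)`. -/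
noncomputable def quotientMatNorm (n : ℕ) (q : Matrix (Fin n) (Fin n) (Y ⧸ X)) : ℝ :=
  sInf (matNorm n '' {y | y.map X.mkQ = q})

variable {X}

theorem quotientMatNorm_map_le {n : ℕ} (y : Matrix (Fin n) (Fin n) Y) :
    quotientMatNorm X n (y.map X.mkQ) ≤ matNorm n y :=
  csInf_le ⟨0, by rintro _ ⟨z, _, rfl⟩; exact apply_nonneg _ _⟩ ⟨y, rfl, rfl⟩

theorem exists_lift_matNorm_lt {n : ℕ} (q : Matrix (Fin n) (Fin n) (Y ⧸ X)) {ε : ℝ} (hε : 0 < ε) :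
    ∃ y : Matrix (Fin n) (Fin n) Y, y.map X.mkQ = q ∧ matNorm n y < quotientMatNorm X n q + ε := by
  have hne : (matNorm n '' {y : Matrix (Fin n) (Fin n) Y | y.map X.mkQ = q}).Nonempty := by
    refine Set.Nonempty.image _ ⟨q.map (Function.surjInv X.mkQ_surjective), ?_⟩
    ext i j
    exact Function.surjInv_eq X.mkQ_surjective (q i j)
  obtain ⟨_, ⟨y, hy, rfl⟩, h⟩ := exists_lt_of_csInf_lt hne
    (lt_add_of_pos_right (quotientMatNorm X n q) hε)
  exact ⟨y, hy, h⟩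

theorem quotientMatNorm_nonneg {n : ℕ} (q : Matrix (Fin n) (Fin n) (Y ⧸ X)) :
    0 ≤ quotientMatNorm X n q :=
  Real.sInf_nonneg (by rintro _ ⟨z, _, rfl⟩; exact apply_nonneg _ _)

open scoped Matrix.Norms.L2Operator in
/-- The quotient of an operator space by a closed subspace. -/
noncomputable instance [IsClosed (X : Set Y)] : OperatorSpace (Y ⧸ X) where
  matNorm n := Seminorm.ofSMulLE (quotientMatNorm X n)
    (le_antisymm (by
      have := quotientMatNorm_map_le (X := X) (0 : Matrix (Fin n) (Fin n) Y)
      rwa [Matrix.map_zero _ (map_zero _), map_zero] at this) (quotientMatNorm_nonneg _))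
    (fun p q => le_of_forall_pos_le_add fun ε hε => by
      obtain ⟨x, rfl, hx'⟩ := exists_lift_matNorm_lt p (half_pos hε)
      obtain ⟨y, rfl, hy'⟩ := exists_lift_matNorm_lt q (half_pos hε)
      have h1 := quotientMatNorm_map_le (X := X) (x + y)
      have h2 : (x + y).map X.mkQ = x.map X.mkQ + y.map X.mkQ := Matrix.map_add _ (map_add _) _ _
      rw [h2] at h1
      linarith [map_add_le_add (matNorm n) x y])
    (fun c q => le_of_forall_pos_le_add fun ε hε => by
      -- The summand `1` avoids a division by zero when `c = 0`.
      have hc : 0 < ‖c‖ + 1 := by positivity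
      obtain ⟨x, rfl, hx'⟩ := exists_lift_matNorm_lt q (div_pos hε hc)
      have h1 := quotientMatNorm_map_le (X := X) (c • x)
      have h2 : (c • x).map X.mkQ = c • x.map X.mkQ := Matrix.map_smul _ _ (map_smul _ _) _
      rw [h2, map_smul_eq_mul] at h1
      have h3 := mul_le_mul_of_nonneg_left hx'.le (norm_nonneg c)
      have h4 : ‖c‖ * (ε / (‖c‖ + 1)) ≤ ε := by
        rw [mul_div_assoc', div_le_iff₀ hc]
        nlinarith
      linarith)
  matNorm_one q := by
    change quotientMatNorm X 1 (Matrix.of fun _ _ => q) = ‖q‖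
    refine le_antisymm (le_of_forall_pos_le_add fun ε hε => ?_)
      (le_of_forall_pos_le_add fun ε hε => ?_)
    · obtain ⟨y, rfl, hy⟩ := Submodule.Quotient.norm_mk_lt q hε
      refine le_trans ?_ hy.le
      rw [← matNorm_one]
      exact quotientMatNorm_map_le (Matrix.of fun _ _ => y)
    · obtain ⟨y, hy, h⟩ := exists_lift_matNorm_lt (X := X) (n := 1) (Matrix.of fun _ _ => q) hε
      refine le_trans ?_ h.le
      have h1 : q = Submodule.Quotient.mk (y 0 0) := (congrFun (congrFun hy 0) 0).symm
      rw [h1]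
      exact (Submodule.Quotient.norm_mk_le _ _).trans (norm_entry_le_matNorm y 0 0)
  matNorm_directSum {m n} p q := by
    change quotientMatNorm X (m + n) (directSum p q) =
      max (quotientMatNorm X m p) (quotientMatNorm X n q)
    refine le_antisymm (le_of_forall_pos_le_add fun ε hε => ?_)
      (le_of_forall_pos_le_add fun ε hε => ?_)
    · obtain ⟨x, rfl, hx'⟩ := exists_lift_matNorm_lt p hε
      obtain ⟨y, rfl, hy'⟩ := exists_lift_matNorm_lt q hε
      rw [← map_directSum]
      refine (quotientMatNorm_map_le _).trans ?_
      rw [matNorm_directSum, ← max_add_add_right]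
      exact max_le_max hx'.le hy'.le
    -- A lift of the direct sum need not be block diagonal, but its diagonal blocks are lifts of `p`
    -- and `q` of no larger norm.
    · obtain ⟨z, hz, hz'⟩ := exists_lift_matNorm_lt (directSum p q) hε
      have hp : (z.submatrix (Fin.castAdd n) (Fin.castAdd n)).map X.mkQ = p := by
        rw [← Matrix.submatrix_map, hz]
        ext i j
        simp [directSum]
      have hq : (z.submatrix (Fin.natAdd m) (Fin.natAdd m)).map X.mkQ = q := by
        rw [← Matrix.submatrix_map, hz]
        ext i j
        simp [directSum]
      refine le_trans (max_le ?_ ?_) hz'.le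
      · rw [← hp]
        exact (quotientMatNorm_map_le _).trans (matNorm_submatrix_le z
          (Fin.castAdd_injective m n) (Fin.castAdd_injective m n))
      · rw [← hq]
        exact (quotientMatNorm_map_le _).trans (matNorm_submatrix_le z
          (Fin.natAdd_injective n m) (Fin.natAdd_injective n m))
  matNorm_sandwich_le {m n} a q b := by
    change quotientMatNorm X n (sandwich a q b) ≤ _ * quotientMatNorm X m q * _
    refine le_of_forall_pos_le_add fun ε hε => ?_
    set c := ‖a‖ * ‖b‖
    have hc : 0 < c + 1 := by positivity
    obtain ⟨x, rfl, hx'⟩ := exists_lift_matNorm_lt q (div_pos hε hc)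
    rw [← map_sandwich]
    refine (quotientMatNorm_map_le _).trans ((matNorm_sandwich_le a x b).trans ?_)
    have h3 := mul_le_mul_of_nonneg_left hx'.le (show 0 ≤ c by positivity)
    have h4 : c * (ε / (c + 1)) ≤ ε := by
      rw [mul_div_assoc', div_le_iff₀ hc]
      nlinarith
    nlinarith

variable [IsClosed (X : Set Y)]

theorem matNorm_map_mkQ_le {n : ℕ} (y : Matrix (Fin n) (Fin n) Y) :
    matNorm n (y.map X.mkQ) ≤ matNorm n y :=
  quotientMatNorm_map_le y

theorem exists_matNorm_lift_lt {n : ℕ} (q : Matrix (Fin n) (Fin n) (Y ⧸ X)) {ε : ℝ} (hε : 0 < ε) :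
    ∃ y : Matrix (Fin n) (Fin n) Y, y.map X.mkQ = q ∧ matNorm n y < matNorm n q + ε :=
  exists_lift_matNorm_lt q hε

end Quotient

/-! ### Smith's lemma -/

section Smith

open scoped Matrix.Norms.L2Operator

/-- A subspace of dimension at most `N` of an inner product space has an orthonormal basis padded
with zeros to a family of length `N`. -/
theorem exists_padded_orthonormalBasis {E : Type*} [NormedAddCommGroup E] [InnerProductSpace ℂ E]
    (S : Submodule ℂ E) [FiniteDimensional ℂ S] {N : ℕ} (hN : Module.finrank ℂ S ≤ N) :
    ∃ u : Fin N → E, (∀ x ∈ S, ∑ k, inner ℂ (u k) x • u k = x) ∧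
      ∀ x, ∑ k, ‖inner ℂ (u k) x‖ ^ 2 ≤ ‖x‖ ^ 2 := by
  obtain ⟨r, rfl⟩ := Nat.exists_eq_add_of_le hN
  let b := stdOrthonormalBasis ℂ S
  refine ⟨Fin.append (fun k => (b k : E)) 0, fun x hx => ?_, fun x => ?_⟩
  · have h := congrArg S.subtype (b.sum_repr' ⟨x, hx⟩)
    simpa [Fin.sum_univ_add] using h
  · have h : Orthonormal ℂ fun k => (b k : E) := b.orthonormal.comp_linearIsometry S.subtypeₗᵢ
    simpa [Fin.sum_univ_add] using h.sum_inner_products_le (s := Finset.univ) x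

/-- A matrix with `N` columns is fixed by `b bᴴ` for some contraction `b` with `N` columns. -/
theorem exists_contraction_mul_conjTranspose_mul {m N : ℕ} (V : Matrix (Fin m) (Fin N) ℂ) :
    ∃ b : Matrix (Fin m) (Fin N) ℂ, ‖b‖ ≤ 1 ∧ b * (b.conjTranspose * V) = V := by
  let col : Fin N → EuclideanSpace ℂ (Fin m) := fun k => WithLp.toLp 2 fun i => V i k
  have : FiniteDimensional ℂ (Submodule.span ℂ (Set.range col)) :=
    FiniteDimensional.span_of_finite ℂ (Set.finite_range col)
  obtain ⟨u, hu, hu'⟩ := exists_padded_orthonormalBasis (Submodule.span ℂ (Set.range col)) (N := N)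
    ((finrank_range_le_card col).trans (by simp))
  refine ⟨Matrix.of fun i k => u k i, ?_, ?_⟩
  -- The adjoint of `b` takes `x` to its coefficients against the family `u`, so it is a contraction
  -- by Bessel's inequality.
  · rw [← Matrix.l2_opNorm_conjTranspose, Matrix.l2_opNorm_def]
    refine ContinuousLinearMap.opNorm_le_bound _ zero_le_one fun x => ?_
    refine le_of_sq_le_sq ?_ (by positivity)
    rw [one_mul, EuclideanSpace.norm_sq_eq]
    refine le_trans (le_of_eq ?_) (hu' x)
    refine Finset.sum_congr rfl fun k _ => ?_
    simp [Matrix.mulVec, dotProduct, PiLp.inner_apply, mul_comm]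
  · ext i k
    have h := congrArg (fun z : EuclideanSpace ℂ (Fin m) => z i)
      (hu (col k) (Submodule.subset_span ⟨k, rfl⟩))
    simpa [Matrix.mul_apply, PiLp.inner_apply, col, mul_comm] using h

/-- Any number `m` of vectors in an `N`-dimensional space is encoded by `N` of them through a
contraction: the vectors form an `m × N` matrix, whose column space has dimension at most `N`. -/
theorem exists_contraction_sum_smul {m N : ℕ} (v : Fin m → EuclideanSpace ℂ (Fin N)) :
    ∃ b : Matrix (Fin m) (Fin N) ℂ, ‖b‖ ≤ 1 ∧
      ∀ i, ∑ k, b i k • ∑ l, b.conjTranspose k l • v l = v i := by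
  obtain ⟨b, hb, h⟩ := exists_contraction_mul_conjTranspose_mul (Matrix.of fun i k => v i k)
  refine ⟨b, hb, fun i => ?_⟩
  ext k
  simpa [Matrix.mul_apply] using congrFun (congrFun h i) k

theorem sum_norm_sq_le_of_contraction {H : Type*} [NormedAddCommGroup H] [InnerProductSpace ℂ H]
    {m n : ℕ} {a : Matrix (Fin n) (Fin m) ℂ} (ha : ‖a‖ ≤ 1) (v : Fin m → H) :
    ∑ i, ‖∑ k, a i k • v k‖ ^ 2 ≤ ∑ k, ‖v k‖ ^ 2 := by
  refine (sum_norm_sq_le a v).trans (mul_le_of_le_one_left (by positivity) ?_)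
  exact pow_le_one₀ (norm_nonneg _) ha

variable {X : Type*} [NormedAddCommGroup X] [NormedSpace ℂ X] [OperatorSpace X]

theorem matNorm_eq_norm_toOp {H : Type*} [NormedAddCommGroup H] [InnerProductSpace ℂ H]
    {n : ℕ} (x : Matrix (Fin n) (Fin n) (H →L[ℂ] H)) : matNorm n x = ‖toOp n x‖ := rfl

theorem matNorm_sandwich_le_of_contraction {m n : ℕ} {a : Matrix (Fin n) (Fin m) ℂ}
    {b : Matrix (Fin m) (Fin n) ℂ} (ha : ‖a‖ ≤ 1) (hb : ‖b‖ ≤ 1) (x : Matrix (Fin m) (Fin m) X) :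
    matNorm n (sandwich a x b) ≤ matNorm m x := by
  have h0 : 0 ≤ matNorm m x := apply_nonneg _ x
  calc _ ≤ ‖a‖ * matNorm m x * ‖b‖ := matNorm_sandwich_le a x b
    _ ≤ 1 * matNorm m x * 1 := by gcongr
    _ = _ := by ring

/-- Smith's lemma: the completely bounded norm of a map into `M_N` is attained at level `N`. -/
theorem cbNorm_le_ampNorm_matrixSpace {N : ℕ} (T : X →ₗ[ℂ] MatrixSpace N) :
    cbNorm T ≤ ampNorm N T := by
  rcases eq_or_ne (ampNorm N T) ∞ with htop | htop
  · simp [htop]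
  set c := (ampNorm N T).toReal with hc
  have hc0 : 0 ≤ c := ENNReal.toReal_nonneg
  have hT : ampNorm N T = ENNReal.ofReal c := (ENNReal.ofReal_toReal htop).symm
  rw [hT]
  refine cbNorm_le_ofReal hc0 fun m x => ?_
  have hx0 : 0 ≤ matNorm m x := apply_nonneg _ x
  rw [matNorm_eq_norm_toOp]
  refine toOp_norm_le _ (by positivity) fun v => ?_
  set w : Fin m → EuclideanSpace ℂ (Fin N) := fun i => ∑ j, x.map T i j (v j) with hw
  -- Both the argument `v` and its image `w` factor through `N` vectors. Compressing `x` by the two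
  -- contractions yields an `N × N` matrix with norm at most that of `x`, whose amplified image
  -- under `T` takes `v'` to `w'`.
  obtain ⟨b, hb, hbv⟩ := exists_contraction_sum_smul v
  obtain ⟨a, ha, haw⟩ := exists_contraction_sum_smul w
  have ha' : ‖a.conjTranspose‖ ≤ 1 := by rwa [Matrix.l2_opNorm_conjTranspose]
  have hb' : ‖b.conjTranspose‖ ≤ 1 := by rwa [Matrix.l2_opNorm_conjTranspose]
  set v' : Fin N → EuclideanSpace ℂ (Fin N) := fun k => ∑ l, b.conjTranspose k l • v l
  set w' : Fin N → EuclideanSpace ℂ (Fin N) := fun k => ∑ l, a.conjTranspose k l • w l with hw'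
  have hbv' : ∀ i, ∑ k, b i k • v' k = v i := hbv
  have haw' : ∀ i, ∑ k, a i k • w' k = w i := haw
  have hw'v' : ∀ k, w' k = ∑ l, (sandwich a.conjTranspose x b).map T k l (v' l) := by
    intro k
    rw [map_sandwich]
    have h1 : ∀ i, w i = ∑ j, ∑ l, b j l • x.map T i j (v' l) := by
      intro i
      simp only [hw]
      refine Finset.sum_congr rfl fun j _ => ?_
      rw [← hbv' j, map_sum]
      simp only [map_smul]
    simp only [hw', h1, sandwich, sum_apply, smul_apply, Finset.smul_sum, smul_smul]
    rw [Finset.sum_comm' (t' := Finset.univ) (s' := fun _ => Finset.univ) (by simp)]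
    conv_rhs => rw [Finset.sum_comm]
    rw [Finset.sum_comm]
    refine Finset.sum_congr rfl fun i _ => ?_
    rw [Finset.sum_comm]
  have h1 : ∑ i, ‖w i‖ ^ 2 ≤ ∑ k, ‖w' k‖ ^ 2 := by
    simpa only [haw'] using sum_norm_sq_le_of_contraction ha w'
  have h2 : ∑ k, ‖v' k‖ ^ 2 ≤ ∑ i, ‖v i‖ ^ 2 := sum_norm_sq_le_of_contraction hb' v
  have h3 : ∑ k, ‖w' k‖ ^ 2 ≤ (c * matNorm m x) ^ 2 * ∑ k, ‖v' k‖ ^ 2 := by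
    simp only [hw'v']
    refine (toOp_norm_bound _ v').trans ?_
    gcongr
    rw [← matNorm_eq_norm_toOp]
    refine (matNorm_map_le_of_ampNorm_le hc0 hT.le _).trans ?_
    gcongr
    exact matNorm_sandwich_le_of_contraction ha' hb x
  exact h1.trans (h3.trans (by gcongr))

end Smith

/-! ### Uniform exactness implies finite matrix type -/

section FiniteMatrixType

variable {X : Type*} [NormedAddCommGroup X] [NormedSpace ℂ X] [OperatorSpace X]
  {Y : Type*} [NormedAddCommGroup Y] [NormedSpace ℂ Y] [OperatorSpace Y]

theorem ampNorm_subtype_comp (S : Submodule ℂ Y) (n : ℕ) (T : X →ₗ[ℂ] S) :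
    ampNorm n (S.subtype ∘ₗ T) = ampNorm n T := rfl

theorem cbNorm_subtype_comp (S : Submodule ℂ Y) (T : X →ₗ[ℂ] S) :
    cbNorm (S.subtype ∘ₗ T) = cbNorm T := rfl

/-- Transport to `G` by an isomorphism, apply Smith's lemma there, and transport back. As the
distance is an infimum, this gives the bound for every `t > C`; then `t` tends to `C`. -/
theorem cbNorm_le_ampNorm_of_cbDist_le {C : ℝ≥0∞} (hC : 1 ≤ C) (hC' : C ≠ ∞) {N : ℕ}
    {G : Submodule ℂ (MatrixSpace N)} (h : cbDist Y G ≤ C) (T : X →ₗ[ℂ] Y) :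
    cbNorm T ≤ C * ampNorm N T := by
  have key : ∀ t, C < t → cbNorm T ≤ t * ampNorm N T := by
    intro t ht
    obtain ⟨s, ⟨_, e, _, _, hes⟩, hst⟩ := sInf_lt_iff.1 (h.trans_lt ht)
    calc cbNorm T = cbNorm (e.symm.toLinearMap ∘ₗ (e.toLinearMap ∘ₗ T)) := by
          congr 1; ext x; simp
      _ ≤ cbNorm e.symm.toLinearMap * cbNorm (e.toLinearMap ∘ₗ T) := cbNorm_comp_le _ _
      _ ≤ cbNorm e.symm.toLinearMap * ampNorm N (e.toLinearMap ∘ₗ T) := by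
          gcongr
          exact cbNorm_le_ampNorm_matrixSpace (G.subtype ∘ₗ (e.toLinearMap ∘ₗ T))
      _ ≤ cbNorm e.symm.toLinearMap * (cbNorm e.toLinearMap * ampNorm N T) := by
          gcongr
          exact (ampNorm_comp_le _ _ _).trans (by gcongr; exact ampNorm_le_cbNorm _ _)
      _ = cbNorm e.toLinearMap * cbNorm e.symm.toLinearMap * ampNorm N T := by ring
      _ ≤ t * ampNorm N T := by gcongr; exact hes.trans hst.le
  rcases eq_or_ne (ampNorm N T) ∞ with htop | htop
  · rw [htop, ENNReal.mul_top (zero_lt_one.trans_le hC).ne']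
    exact le_top
  · have : (𝓝[>] C).NeBot := nhdsGT_neBot_of_exists_gt ⟨∞, hC'.lt_top⟩
    have hlim : Filter.Tendsto (fun t => t * ampNorm N T) (𝓝[>] C) (𝓝 (C * ampNorm N T)) :=
      (ENNReal.Tendsto.mul_const Filter.tendsto_id (Or.inr htop)).mono_left nhdsWithin_le_nhds
    exact ge_of_tendsto hlim (Filter.eventually_of_mem self_mem_nhdsWithin key)

theorem IsUniformlyExact.isOfFiniteMatrixType {ι : Type*} {C : ℝ} {Z : ι → Type u}
    [∀ j, NormedAddCommGroup (Z j)] [∀ j, NormedSpace ℂ (Z j)] [∀ j, OperatorSpace (Z j)]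
    (h : IsUniformlyExact C Z) : IsOfFiniteMatrixType C Z := by
  obtain ⟨hC, N, hN⟩ := h
  -- The range of a map from `F` may have any dimension up to that of `F`, hence the maximum of `N`
  -- over these dimensions.
  refine ⟨hC, fun F _ _ _ _ => ⟨(Finset.range (Module.finrank ℂ F + 1)).sup N, fun j T => ?_⟩⟩
  obtain ⟨G, hG⟩ := hN _ j (LinearMap.range T) inferInstance rfl
  have h1 := cbNorm_le_ampNorm_of_cbDist_le (by simpa using hC) ENNReal.ofReal_ne_top hG
    T.rangeRestrict
  have e : (LinearMap.range T).subtype ∘ₗ T.rangeRestrict = T := by ext; rfl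
  rw [← cbNorm_subtype_comp, ← ampNorm_subtype_comp, e] at h1
  refine h1.trans ?_
  gcongr
  exact ampNorm_mono T (Finset.le_sup (by
    simpa [Nat.lt_succ_iff] using T.finrank_range_le))

end FiniteMatrixType

/-! ### Diagonal choice and null families of matrices -/

open Filter in
/-- Diagonal choice: properties that each hold eventually hold along some index tending to `∞`. -/
theorem exists_tendsto_atTop_forall {P : ℕ → ℕ → Prop} (h0 : ∀ j, P 0 j)
    (h : ∀ k, ∀ᶠ j in atTop, P k j) : ∃ κ : ℕ → ℕ, Tendsto κ atTop atTop ∧ ∀ j, P (κ j) j := by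
  classical
  refine ⟨fun j => Nat.findGreatest (fun k => P k j) j, tendsto_atTop.2 fun k => ?_, fun j =>
    Nat.findGreatest_spec (P := fun k => P k j) (Nat.zero_le j) (h0 j)⟩
  filter_upwards [h k, eventually_ge_atTop k] with j hj hkj
  exact Nat.le_findGreatest hkj hj

/-- The constant of `exists_matNorm_le` depends on `n` only, so the space `W a` may vary with `a`.
-/
theorem tendsto_matNorm_zero {α : Type*} {l : Filter α} {n : ℕ} {W : α → Type u}
    [∀ a, NormedAddCommGroup (W a)] [∀ a, NormedSpace ℂ (W a)] [∀ a, OperatorSpace (W a)]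
    {y : ∀ a, Matrix (Fin n) (Fin n) (W a)}
    (h : ∀ i k, Filter.Tendsto (fun a => ‖y a i k‖) l (𝓝 0)) :
    Filter.Tendsto (fun a => matNorm n (y a)) l (𝓝 0) := by
  obtain ⟨K, _, hK⟩ := exists_matNorm_le.{u} n
  refine squeeze_zero (fun a => apply_nonneg _ _) (fun a => hK _ (y a)) ?_
  have := (tendsto_finsetSum Finset.univ fun i _ =>
    tendsto_finsetSum Finset.univ fun k _ => h i k).const_mul K
  simpa using this

/-! ### Maps into the `c_0`-sum and their corrections -/

section Sums

variable {Z : ℕ → Type u} [∀ j, NormedAddCommGroup (Z j)] [∀ j, NormedSpace ℂ (Z j)]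
  [∀ j, OperatorSpace (Z j)]

/-- The `j`-th coordinate of a map into `(Z_j)_{c_0}`. -/
noncomputable def c0Coord {X : Type*} [AddCommGroup X] [Module ℂ X] (T : X →ₗ[ℂ] c0Sum Z) (j : ℕ) :
    X →ₗ[ℂ] Z j :=
  lp.evalₗ (𝕜 := ℂ) Z ∞ j ∘ₗ (c0Sum Z).subtype ∘ₗ T

theorem matNorm_c0Sum {n : ℕ} (x : Matrix (Fin n) (Fin n) (c0Sum Z)) :
    matNorm n x = ⨆ j, matNorm n (x.map fun f => (f : lp Z ∞) j) := rfl

theorem cbNorm_c0Coord_le {X : Type*} [NormedAddCommGroup X] [NormedSpace ℂ X] [OperatorSpace X]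
    (T : X →ₗ[ℂ] c0Sum Z) (j : ℕ) : cbNorm (c0Coord T j) ≤ cbNorm T :=
  iSup_le fun n => (ampNorm_le_of_forall fun x => by
    refine le_trans ?_ (ofReal_matNorm_map_le n T x)
    refine ENNReal.ofReal_le_ofReal ?_
    rw [matNorm_c0Sum]
    exact le_ciSup (bddAbove_matNorm Z n ((x.map T).map (c0Sum Z).subtype)) j).trans
      (ampNorm_le_cbNorm n T)

variable {Y : Type u} [NormedAddCommGroup Y] [NormedSpace ℂ Y] [OperatorSpace Y]

/-- A pointwise null sequence of uniformly completely bounded maps defines a completely bounded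
map into the `c_0`-sum. -/
theorem exists_c0Sum_map {B : ∀ j, Y →ₗ[ℂ] Z j} {c : ℝ} (hc : 0 ≤ c)
    (hB : ∀ j, cbNorm (B j) ≤ ENNReal.ofReal c)
    (hB0 : ∀ y, Filter.Tendsto (fun j => ‖B j y‖) Filter.atTop (𝓝 0)) :
    ∃ T : Y →ₗ[ℂ] c0Sum Z, (∀ y j, (T y : lp Z ∞) j = B j y) ∧ cbNorm T ≤ ENNReal.ofReal c := by
  have hmem : ∀ y, Memℓp (fun j => B j y) ∞ := fun y => memℓp_infty ⟨c * ‖y‖, by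
    rintro _ ⟨j, rfl⟩
    exact norm_apply_le_of_cbNorm_le hc (hB j) y⟩
  let T : Y →ₗ[ℂ] c0Sum Z :=
    { toFun := fun y => ⟨⟨fun j => B j y, hmem y⟩, hB0 y⟩
      map_add' := fun x y => by ext j; exact map_add (B j) x y
      map_smul' := fun a y => by ext j; exact map_smul (B j) a y }
  refine ⟨T, fun y j => rfl, cbNorm_le_ofReal hc fun n x => ?_⟩
  rw [matNorm_c0Sum]
  exact ciSup_le fun j => matNorm_map_le_of_cbNorm_le hc (hB j) n x

variable {X : Submodule ℂ Y}

open Filter in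
/-- Operators that tend to `0` on `X` and have norms at most `c` induce on a finite-dimensional
subspace of `Y/X`, up to a small error, operators with `n`-th norms at most `c`. -/
theorem eventually_ampNorm_comp_section_le [IsClosed (X : Set Y)]
    {A : ∀ j, Y →ₗ[ℂ] Z j} {c : ℝ} (hc : 0 ≤ c)
    (hA : ∀ j, cbNorm (A j) ≤ ENNReal.ofReal c)
    (hA0 : ∀ x ∈ X, Tendsto (fun j => ‖A j x‖) atTop (𝓝 0))
    (F : Submodule ℂ (Y ⧸ X)) [FiniteDimensional ℂ F] (σ : F →ₗ[ℂ] Y)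
    (hσ : ∀ q, X.mkQ (σ q) = q) (n : ℕ) {δ : ℝ} (hδ : 0 < δ) :
    ∀ᶠ j in atTop, ampNorm n (A j ∘ₗ σ) ≤ ENNReal.ofReal (c + δ) := by
  -- This product of balls contains the unit ball of `M_n(F)`, since entries are bounded by the
  -- matrix norm.
  have hK : IsCompact (Set.univ.pi fun _ : Fin n => Set.univ.pi fun _ : Fin n =>
      Metric.closedBall (0 : F) 1) :=
    have : ProperSpace F := FiniteDimensional.proper ℂ F
    isCompact_univ_pi fun _ => isCompact_univ_pi fun _ => isCompact_closedBall _ _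
  suffices h : ∀ᶠ j in atTop, ∀ x : Matrix (Fin n) (Fin n) F,
      x ∈ (Set.univ.pi fun _ : Fin n => Set.univ.pi fun _ : Fin n => Metric.closedBall (0 : F) 1) →
        matNorm n (x.map (A j ∘ₗ σ)) ≤ c * matNorm n x + δ by
    filter_upwards [h] with j hj
    refine ampNorm_le_ofReal fun x hx => (hj x fun i _ k _ => ?_).trans ?_
    · simpa using (norm_entry_le_matNorm x i k).trans hx
    · nlinarith
  refine hK.induction_on (p := fun s => ∀ᶠ j in atTop, ∀ x : Matrix (Fin n) (Fin n) F, x ∈ s →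
    matNorm n (x.map (A j ∘ₗ σ)) ≤ c * matNorm n x + δ)
    (Eventually.of_forall fun j x hx => absurd hx (Set.notMem_empty _))
    (fun s t hst ht => ht.mono fun j hj x hx => hj x (hst hx))
    (fun s t hs ht => ?_) (fun x₀ _ => ?_)
  · filter_upwards [hs, ht] with j h1 h2 x hx
    exact hx.elim (h1 x) (h2 x)
  let x₁ : Matrix (Fin n) (Fin n) F := x₀
  have hη : 0 < δ / 3 / (c + 1) := by positivity
  have hcη : c * (δ / 3 / (c + 1)) ≤ δ / 3 := by
    rw [mul_div_assoc', div_le_iff₀ (by positivity)]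
    nlinarith
  obtain ⟨y, hy, hy'⟩ := exists_matNorm_lift_lt (x₁.map F.subtype) hη
  rw [← matNorm_coe] at hy'
  have hσc : Continuous σ := σ.continuous_of_finiteDimensional
  have hent : ∀ i k, Tendsto (fun x : Matrix (Fin n) (Fin n) F => x i k - x₁ i k) (𝓝 x₁) (𝓝 0) := by
    intro i k
    have : Continuous fun x : Matrix (Fin n) (Fin n) F => x i k - x₁ i k := by fun_prop
    simpa using this.tendsto x₁
  have h1 : Tendsto (fun x : Matrix (Fin n) (Fin n) F => matNorm n (x - x₁)) (𝓝 x₁) (𝓝 0) :=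
    tendsto_matNorm_zero fun i k => by simpa using (hent i k).norm
  have h2 : Tendsto (fun x : Matrix (Fin n) (Fin n) F => matNorm n ((x - x₁).map σ))
      (𝓝 x₁) (𝓝 0) :=
    tendsto_matNorm_zero fun i k => by
      simpa using ((hσc.tendsto 0).comp (hent i k)).norm
  have h3 : ∀ᶠ x : Matrix (Fin n) (Fin n) F in 𝓝 x₁,
      c * (matNorm n (x - x₁) + matNorm n ((x - x₁).map σ)) < δ / 3 :=
    ((h1.add h2).const_mul c).eventually_lt_const (by simpa using by positivity)
  -- The two lifts `y` and `x₁.map σ` of `x₁` differ by a matrix over `X`. Three errors of at most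
  -- `δ / 3` arise: from the lift, from this difference, and from replacing `x₁` by `x`.
  have h4 : Tendsto (fun j => matNorm n ((y - x₁.map σ).map (A j))) atTop (𝓝 0) :=
    tendsto_matNorm_zero fun i k => hA0 (y i k - σ (x₁ i k)) (by
      have e : X.mkQ (y i k) = X.mkQ (σ (x₁ i k)) :=
        (congrFun (congrFun hy i) k).trans (hσ _).symm
      exact (Submodule.Quotient.eq X).1 e)
  refine ⟨_, mem_nhdsWithin_of_mem_nhds h3, ?_⟩
  filter_upwards [h4.eventually_lt_const (show 0 < δ / 3 by positivity)] with j hj x hx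
  have hx' : c * (matNorm n (x - x₁) + matNorm n ((x - x₁).map σ)) < δ / 3 := hx
  have e : x.map (A j ∘ₗ σ) =
      y.map (A j) - (y - x₁.map σ).map (A j) + ((x - x₁).map σ).map (A j) := by
    ext i k
    simp
  have b1 := matNorm_map_le_of_cbNorm_le hc (hA j) n y
  have b2 := matNorm_map_le_of_cbNorm_le hc (hA j) n ((x - x₁).map σ)
  have b3 : matNorm n (x.map (A j ∘ₗ σ)) ≤ matNorm n (y.map (A j)) +
      matNorm n ((y - x₁.map σ).map (A j)) + matNorm n (((x - x₁).map σ).map (A j)) := by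
    rw [e]
    refine (map_add_le_add _ _ _).trans ?_
    gcongr
    exact map_sub_le_add _ _ _
  have b4 : matNorm n x₁ ≤ matNorm n x + matNorm n (x - x₁) := by
    have := map_sub_le_add (matNorm n) x (x - x₁)
    rwa [sub_sub_cancel] at this
  have b5 := mul_le_mul_of_nonneg_left hy'.le hc
  have b6 := mul_le_mul_of_nonneg_left b4 hc
  nlinarith

-- This produces the correction: finite matrix type costs the factor `C`, and extension from the
-- span of the first `k` classes to `Y ⧸ X` costs the factor `lam`.
open Filter in
theorem eventually_exists_quotient_approx [CompleteSpace Y] [IsClosed (X : Set Y)]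
    {lam C : ℝ} (hlam : 0 ≤ lam)
    (hinj : ∀ j, IsInjectiveWith lam (Z j)) (hZ : IsOfFiniteMatrixType C Z)
    {A : ∀ j, Y →ₗ[ℂ] Z j} {c : ℝ} (hc : 0 ≤ c)
    (hA : ∀ j, cbNorm (A j) ≤ ENNReal.ofReal c)
    (hA0 : ∀ x ∈ X, Tendsto (fun j => ‖A j x‖) atTop (𝓝 0))
    (y : ℕ → Y) (k : ℕ) {δ η : ℝ} (hδ : 0 < δ) (hη : 0 < η) :
    ∀ᶠ j in atTop, ∃ S : (Y ⧸ X) →ₗ[ℂ] Z j, cbNorm S ≤ ENNReal.ofReal (lam * (C * (c + δ))) ∧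
      ∀ i < k, ‖A j (y i) - S (X.mkQ (y i))‖ ≤ η := by
  let F : Submodule ℂ (Y ⧸ X) := Submodule.span ℂ ((fun i => X.mkQ (y i)) '' Set.Iio k)
  have : FiniteDimensional ℂ F := FiniteDimensional.span_of_finite ℂ ((Set.finite_Iio k).image _)
  -- The section `τ` is only algebraic and may be unbounded; its restriction to `F` is continuous
  -- because `F` is finite-dimensional.
  obtain ⟨τ, hτ⟩ := X.mkQ.exists_rightInverse_of_surjective X.range_mkQ
  have hτ' : ∀ q, X.mkQ (τ q) = q := fun q => LinearMap.congr_fun hτ q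
  obtain ⟨hC, hZ⟩ := hZ
  obtain ⟨n, hn⟩ := hZ F inferInstance
  have h1 := eventually_ampNorm_comp_section_le hc hA hA0 F (τ ∘ₗ F.subtype) (fun q => hτ' q) n hδ
  have h2 : ∀ᶠ j in atTop, ∀ i ∈ Set.Iio k, ‖A j (y i - τ (X.mkQ (y i)))‖ ≤ η := by
    refine (eventually_all_finite (Set.finite_Iio k)).2 fun i _ => ?_
    have hmem : y i - τ (X.mkQ (y i)) ∈ X := (Submodule.Quotient.eq X).1 (hτ' (X.mkQ (y i))).symm
    exact ((hA0 _ hmem).eventually_lt_const hη).mono fun j hj => hj.le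
  filter_upwards [h1, h2] with j hj1 hj2
  have hR : cbNorm (A j ∘ₗ τ ∘ₗ F.subtype) ≤ ENNReal.ofReal (C * (c + δ)) := by
    rw [ENNReal.ofReal_mul (zero_le_one.trans hC)]
    exact (hn j _).trans (by gcongr)
  obtain ⟨S, hS, hS'⟩ := hinj j (Y ⧸ X) F F.closed_of_finiteDimensional _
    (hR.trans_lt ENNReal.ofReal_lt_top)
  refine ⟨S, ?_, fun i hi => ?_⟩
  · rw [ENNReal.ofReal_mul hlam]
    exact hS'.trans (by gcongr)
  · have h3 := hS ⟨X.mkQ (y i), Submodule.subset_span ⟨i, hi, rfl⟩⟩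
    rw [h3]
    simpa using hj2 i hi

open Filter in
/-- Maps that tend to `0` on `X`, on lifts of a dense sequence of `Y/X`, and are uniformly bounded,
tend to `0` on `Y`. -/
theorem tendsto_norm_zero_of_denseRange_mkQ {B : ∀ j, Y →ₗ[ℂ] Z j} {c : ℝ} (hc : 0 ≤ c)
    (hB : ∀ j, cbNorm (B j) ≤ ENNReal.ofReal c)
    (hBX : ∀ x ∈ X, Tendsto (fun j => ‖B j x‖) atTop (𝓝 0)) {y : ℕ → Y}
    (hy : DenseRange fun i => X.mkQ (y i))
    (hBy : ∀ i, Tendsto (fun j => ‖B j (y i)‖) atTop (𝓝 0)) (z : Y) :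
    Tendsto (fun j => ‖B j z‖) atTop (𝓝 0) := by
  refine Metric.tendsto_nhds.2 fun ε hε => ?_
  have hη : 0 < ε / 3 / (c + 1) := by positivity
  have hcη : c * (ε / 3 / (c + 1)) ≤ ε / 3 := by
    rw [mul_div_assoc', div_le_iff₀ (by positivity)]
    nlinarith
  obtain ⟨i, hi⟩ := Metric.denseRange_iff.1 hy (X.mkQ z) _ hη
  rw [dist_eq_norm, ← map_sub] at hi
  -- The class of `z - y i` is small, so it has a small representative `w`, and `z` is `y i + w` up
  -- to an element of `X`.
  obtain ⟨w, hw, hw'⟩ := Submodule.Quotient.norm_mk_lt (X.mkQ (z - y i)) (sub_pos.2 hi)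
  rw [add_sub_cancel] at hw'
  have hx : z - y i - w ∈ X := (Submodule.Quotient.eq X).1 hw.symm
  filter_upwards [(hBX _ hx).eventually_lt_const (show 0 < ε / 3 by positivity),
    (hBy i).eventually_lt_const (show 0 < ε / 3 by positivity)] with j h1 h2
  have h3 : ‖B j w‖ ≤ ε / 3 :=
    (norm_apply_le_of_cbNorm_le hc (hB j) w).trans
      ((mul_le_mul_of_nonneg_left hw'.le hc).trans hcη)
  have e : B j z = B j (z - y i - w) + B j (y i) + B j w := by
    simp only [map_sub]
    abel
  rw [dist_zero_right, norm_norm, e]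
  linarith [norm_add₃_le (a := B j (z - y i - w)) (b := B j (y i)) (c := B j w)]

end Sums

end OpSpace

/-! ### The extension theorem -/

theorem theorem2p2 (Z : ℕ → Type u) [∀ j, NormedAddCommGroup (Z j)]
    [∀ j, NormedSpace ℂ (Z j)] [∀ j, CompleteSpace (Z j)] [∀ j, OpSpace.OperatorSpace (Z j)]
    (lam C : ℝ) (hinj : ∀ j, OpSpace.IsInjectiveWith lam (Z j))
    (hZ : OpSpace.IsUniformlyExact C Z ∨ OpSpace.IsOfFiniteMatrixType C Z)
    (Y : Type u) [NormedAddCommGroup Y] [NormedSpace ℂ Y] [CompleteSpace Y]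
    [OpSpace.OperatorSpace Y]
    (X : Submodule ℂ Y) (hX : IsClosed (X : Set Y))
    (hsep : TopologicalSpace.SeparableSpace (Y ⧸ X))
    (T : X →ₗ[ℂ] OpSpace.c0Sum Z) (hT : OpSpace.IsCompletelyBounded T) (hT0 : T ≠ 0)
    (ε : ℝ) (hε : 0 < ε) :
    ∃ T' : Y →ₗ[ℂ] OpSpace.c0Sum Z, (∀ x : X, T' x = T x) ∧
      OpSpace.cbNorm T' < ENNReal.ofReal (C * lam ^ 2 + lam + ε) * OpSpace.cbNorm T := by
  open OpSpace Filter Topology in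
  have hfmt : IsOfFiniteMatrixType C Z := hZ.elim (fun h => h.isOfFiniteMatrixType) id
  have hC : 0 < C := zero_lt_one.trans_le hfmt.1
  set t := (cbNorm T).toReal with ht_def
  have ht : cbNorm T = ENNReal.ofReal t := (ENNReal.ofReal_toReal hT.ne).symm
  have htpos : 0 < t := ENNReal.toReal_pos (fun h => hT0 (eq_zero_of_cbNorm_eq_zero h)) hT.ne
  have hTj : ∀ j, cbNorm (c0Coord T j) ≤ ENNReal.ofReal t := fun j =>
    (cbNorm_c0Coord_le T j).trans ht.le
  choose A hAext hA using fun j => hinj j Y X hX (c0Coord T j)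
    ((hTj j).trans_lt ENNReal.ofReal_lt_top)
  -- For `lam ≤ 0` all the extensions `A j` would vanish, and so would `T`.
  have hlam : 0 < lam := by
    by_contra! hneg
    refine hT0 (LinearMap.ext fun x => Subtype.ext (lp.ext (funext fun j => ?_)))
    have h0 : A j = 0 := eq_zero_of_cbNorm_eq_zero (le_antisymm
      ((hA j).trans (by simp [ENNReal.ofReal_of_nonpos hneg])) bot_le)
    have h1 := hAext j x
    rw [h0] at h1
    exact h1.symm
  have hc : 0 ≤ lam * t := by positivity
  have hA' : ∀ j, cbNorm (A j) ≤ ENNReal.ofReal (lam * t) := fun j => by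
    rw [ENNReal.ofReal_mul hlam.le]
    exact (hA j).trans (by gcongr; exact hTj j)
  have hA0 : ∀ x ∈ X, Tendsto (fun j => ‖A j x‖) atTop (𝓝 0) := fun x hx => by
    have h1 : ∀ j, A j x = (T ⟨x, hx⟩ : lp Z ⊤) j := fun j => hAext j ⟨x, hx⟩
    simp only [h1]
    exact (T ⟨x, hx⟩).2
  let q : ℕ → Y ⧸ X := TopologicalSpace.denseSeq (Y ⧸ X)
  let y : ℕ → Y := fun i => Function.surjInv X.mkQ_surjective (q i)
  have hyq : (fun i => X.mkQ (y i)) = q := funext fun i => Function.surjInv_eq X.mkQ_surjective _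
  have hy : DenseRange fun i => X.mkQ (y i) := by
    rw [hyq]
    exact TopologicalSpace.denseRange_denseSeq _
  -- Chosen so that the error `lam * C * δ` in the final bound is `ε * t / 2`, which leaves room for
  -- the strict inequality.
  set δ := ε * t / (2 * lam * C) with hδ_def
  have hδ : 0 < δ := by positivity
  set r := lam * (C * (lam * t + δ)) with hr_def
  have hr : 0 ≤ r := by positivity
  -- At stage `k` the correction matches `A j` on the first `k` lifts up to `1 / (k + 1)`. For small
  -- `j` the fallback is stage `0`, with the zero map and no condition.
  obtain ⟨κ, hκ, hS⟩ := exists_tendsto_atTop_forall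
    (P := fun k j => ∃ S : (Y ⧸ X) →ₗ[ℂ] Z j, cbNorm S ≤ ENNReal.ofReal r ∧
      ∀ i < k, ‖A j (y i) - S (X.mkQ (y i))‖ ≤ 1 / ((k : ℝ) + 1))
    (fun j => ⟨0, cbNorm_le_ofReal hr fun n x => by
      have : x.map (0 : (Y ⧸ X) →ₗ[ℂ] Z j) = 0 := by ext; simp
      rw [this, map_zero]
      exact mul_nonneg hr (apply_nonneg _ _), by simp⟩)
    (fun k => eventually_exists_quotient_approx hlam.le hinj hfmt hc hA' hA0 y k hδ
      Nat.one_div_pos_of_nat)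
  choose S hSr hSy using hS
  have hB : ∀ j, cbNorm (A j - S j ∘ₗ X.mkQ) ≤ ENNReal.ofReal (lam * t + r) := fun j =>
    cbNorm_le_ofReal (by positivity) fun n x => by
      have e : x.map (A j - S j ∘ₗ X.mkQ) = x.map (A j) - (x.map X.mkQ).map (S j) := by
        ext i k
        simp
      rw [e, add_mul]
      refine (map_sub_le_add _ _ _).trans ?_
      gcongr
      · exact matNorm_map_le_of_cbNorm_le hc (hA' j) n x
      · refine (matNorm_map_le_of_cbNorm_le hr (hSr j) n _).trans ?_
        gcongr
        exact matNorm_map_mkQ_le x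
  have hBX : ∀ j, ∀ x ∈ X, (A j - S j ∘ₗ X.mkQ) x = A j x := fun j x hx => by
    have : X.mkQ x = 0 := (Submodule.Quotient.mk_eq_zero X).2 hx
    simp [this]
  -- Each `y i` is among the first `κ j` lifts once `κ j > i`, and the tolerance `1 / (κ j + 1)`
  -- tends to `0`.
  have hB0 := tendsto_norm_zero_of_denseRange_mkQ (by positivity) hB
    (fun x hx => by simpa only [hBX _ x hx] using hA0 x hx) hy (fun i =>
      squeeze_zero' (Eventually.of_forall fun _ => norm_nonneg _)
        ((hκ.eventually_gt_atTop i).mono fun j hj => hSy j i hj)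
        (tendsto_one_div_add_atTop_nhds_zero_nat.comp hκ))
  obtain ⟨T', hT', hT'cb⟩ := exists_c0Sum_map (by positivity) hB hB0
  refine ⟨T', fun x => Subtype.ext (lp.ext (funext fun j => ?_)), hT'cb.trans_lt ?_⟩
  · rw [hT', hBX j x x.2]
    exact hAext j x
  · rw [ht, ← ENNReal.ofReal_mul (by positivity), ENNReal.ofReal_lt_ofReal_iff (by positivity)]
    have e : lam * C * δ = ε * t / 2 := by
      rw [hδ_def]
      field_simp
    have : 0 < ε * t := by positivity
    nlinarith
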